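/- Let $R$ be a commutative unital ring, and let $H_*$ denote singular homology with coefficients in $R$. A precubical set is a graded set $P=(P_n)_{n\ge 0}$ with face operators $d^k_i\colon P_n\to P_{n-1}$ ($n>0$, $k\in\{0,1\}$, $1\le i\le n$) satisfying $d^k_id^l_j=d^l_{j-1}d^k_i$ for $i<j$; $|P|$ is its geometric realization. For $y\in P_m$, let $y_\sharp\colon [\![0,1]\!]^{\otimes m}\to P$ be the morphism from the precubical $m$-cube that sends its top element to $y$; $y$ is regular if $y_\sharp$ is injective. For $z\in P$, $\mathrm{star}(z)$ is the set of all $y\in P$ such that $z$ lies in the image of $y_\sharp$. A face $d^k_iy$ is free if $\mathrm{star}(d^k_iy)=\{y,d^k_iy\}$. For vertices $v,w$ write $v\to_P w$ if there is a path in $P$ from $v$ to $w$, i.e. a (possibly empty) finite sequence of consecutive edges, each traversed from its vertex $d^0_1$ to its vertex $d^1_1$. A precubical subset $C$ of $P$ is deformable into a precubical subset $C'$ of $P$ if there is a precubical subset $\hat C$ of $P$ containing $C$ and $C'$ such that the inclusion $|C'|\hookrightarrow|\hat C|$ is a homotopy equivalence. A class $\alpha\in H_*(|P|)$ points to $\beta\in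 H_*(|P|)$, written $\alpha\nearrow\beta$, if there are precubical subsets $X,Y$ of $P$ such that $\alpha\in\mathrm{im}\,H_*(|X|\hookrightarrow|P|)$, $\beta\in\mathrm{im}\,H_*(|Y|\hookrightarrow|P|)$, and $x\to_P y$ for all vertices $x\in X_0$, $y\in Y_0$. Theorem. Let $P$ be a precubical set, let $x$ be a regular element of $P$ of degree $n\ge 2$ with free face $d^k_ix$, let $Q=P\setminus\mathrm{star}(d^k_ix)$, and let $\iota\colon|Q|\hookrightarrow|P|$ be the inclusion. Suppose that every precubical subset $C$ of $P$ is deformable into a precubical subset $C'$ of $Q$ such that for every vertex $c'$ of $C'$ there exists a vertex $c$ of $C$ such that - when $k=0$: $c\to_Q c'$, and if $d^1_1\cdots d^1_1d^0_ix\to_P c$ then $d^1_1\cdots d^1_1x\to_Q c'$; - when $k=1$: $c'\to_Q c$, and if $c\to_P d^0_1\cdots d^0_1d^1_ix$ then $c'\to_Q d^0_1\cdots d^0_1x$. Then $\iota_*\colon H_*(|Q|)\to H_*(|P|)$ is a graph isomorphism, i.e. it is bijective, and for all $\alpha,\beta\in H_*(|Q|)$, $\alpha\nearrow\beta$ (in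 $Q$) if and only if $\iota_*(\alpha)\nearrow\iota_*(\beta)$ (in $P$). -/

import Mathlib

open CategoryTheory AlgebraicTopology
open scoped DirectSum

universe u u₁ u₂ v

/-- A precubical set: a graded set with face operators `d^k_i`, where the Boolean `false` stands
for `k = 0` (front faces), `true` stands for `k = 1` (back faces), and the lower indices
`1, …, n` are counted from `0` to `n - 1`. The relation
`d^k_i ∘ d^l_j = d^l_{j-1} ∘ d^k_i` for `i < j` is written with `j + 1` in place of `j`. -/
structure PrecubicalSet where
  /-- the elements of degree `n` -/
  cell : ℕ → Type u
  /-- the face operators -/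
  face {n : ℕ} (k : Bool) (i : Fin (n + 1)) : cell (n + 1) → cell n
  face_face {n : ℕ} (k l : Bool) (i j : Fin (n + 1)) (hij : i ≤ j) (x : cell (n + 2)) :
    face k i (face l j.succ x) = face l j (face k i.castSucc x)

namespace PrecubicalSet

/-- An element of a precubical set, of any degree. -/
abbrev Elem (P : PrecubicalSet.{u}) : Type u := Σ n : ℕ, P.cell n

/-- A morphism of precubical sets. -/
structure Hom (P : PrecubicalSet.{u₁}) (Q : PrecubicalSet.{u₂}) where
  toFun (n : ℕ) : P.cell n → Q.cell n
  map_face {n : ℕ} (k : Bool) (i : Fin (n + 1)) (x : P.cell (n + 1)) :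
    toFun n (P.face k i x) = Q.face k i (toFun (n + 1) x)

/-! ### The precubical cube, regular elements -/

/-- `CubeCell n m` is the set of elements of degree `m` of the `n`-fold tensor power of the
precubical interval with vertices `0`, `1` and the single edge `[0,1]`: an element is a word of
length `n` in the letters `0`, `1` (`pt false`, `pt true`) and `[0,1]` (`edge`), and its degree is
the number of letters `[0,1]`. -/
inductive CubeCell : ℕ → ℕ → Type
  | nil : CubeCell 0 0
  | pt {n m : ℕ} (k : Bool) (w : CubeCell n m) : CubeCell (n + 1) m
  | edge {n m : ℕ} (w : CubeCell n m) : CubeCell (n + 1) (m + 1)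

namespace CubeCell

/-- `d^k_i` replaces the `i`-th letter `[0,1]` by `k`. -/
def face : {n m : ℕ} → (k : Bool) → Fin (m + 1) → CubeCell n (m + 1) → CubeCell n m
  | _, _, k, i, pt b w => pt b (face k i w)
  | _, 0, k, _, edge w => pt k w
  | _, _ + 1, k, i, edge w => Fin.cases (pt k w) (fun j => edge (face k j w)) i

theorem face_pt {n m : ℕ} (k b : Bool) (i : Fin (m + 1)) (w : CubeCell n (m + 1)) :
    face k i (pt b w) = pt b (face k i w) := by
  simp [face]

theorem face_zero_edge {n m : ℕ} (k : Bool) (w : CubeCell n m) :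
    face k 0 (edge w) = pt k w := by
  cases m <;> simp [face]

theorem face_succ_edge {n m : ℕ} (k : Bool) (i : Fin (m + 1)) (w : CubeCell n (m + 1)) :
    face k i.succ (edge w) = edge (face k i w) := by
  simp [face]

theorem face_face {n : ℕ} : ∀ {m : ℕ} (k l : Bool) (i j : Fin (m + 1)) (_ : i ≤ j)
    (w : CubeCell n (m + 2)), face k i (face l j.succ w) = face l j (face k i.castSucc w) := by
  induction n with
  | zero => intro m k l i j _ w; cases w
  | succ n ih =>
    intro m k l i j hij w
    cases w with
    | pt b w => simp only [face_pt]; rw [ih k l i j hij]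
    | edge w =>
      rw [face_succ_edge]
      revert hij
      refine Fin.cases (fun _ => ?_) (fun i' hij => ?_) i
      · rw [Fin.castSucc_zero, face_zero_edge, face_zero_edge, face_pt]
      · cases m with
        | zero => exact i'.elim0
        | succ m =>
          revert hij
          refine Fin.cases (fun hij => ?_) (fun j' hij => ?_) j
          · exact absurd hij (by simp)
          · rw [← Fin.succ_castSucc, face_succ_edge, face_succ_edge, face_succ_edge,
              ih k l i' j' (Fin.succ_le_succ_iff.1 hij)]

/-- The element `ι_n` of degree `n` of the precubical `n`-cube. -/
def top : (n : ℕ) → CubeCell n n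
  | 0 => nil
  | n + 1 => edge (top n)

end CubeCell

/-- The precubical `n`-cube. -/
def cube (n : ℕ) : PrecubicalSet.{0} where
  cell := CubeCell n
  face := CubeCell.face
  face_face := CubeCell.face_face

/-- The precubical set obtained by forgetting the vertices and the faces `d^k_1`. -/
def shift (P : PrecubicalSet.{u}) : PrecubicalSet.{u} where
  cell n := P.cell (n + 1)
  face k i := P.face k i.succ
  face_face k l i j hij x := by
    have h := P.face_face k l i.succ j.succ (Fin.succ_le_succ_iff.2 hij) x
    rwa [← Fin.succ_castSucc] at h

/-- The values of `x_♯`: the letter `k` at the first place takes the face `d^k_1`. -/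
def sharpFun : {n m : ℕ} → CubeCell n m → (P : PrecubicalSet.{u}) → P.cell n → P.cell m
  | _, _, .nil, _, x => x
  | _, _, .pt k w, P, x => sharpFun w P (P.face k 0 x)
  | _, _, .edge w, P, x => sharpFun w P.shift x

theorem sharpFun_naturality {n m : ℕ} (w : CubeCell n m) :
    ∀ {P : PrecubicalSet.{u₁}} {Q : PrecubicalSet.{u₂}} (f : Hom P Q) (x : P.cell n),
      f.toFun m (sharpFun w P x) = sharpFun w Q (f.toFun n x) := by
  induction w with
  | nil => intro P Q f x; rfl
  | pt k w ih =>
    intro P Q f x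
    simp only [sharpFun]
    rw [ih f, f.map_face]
  | edge w ih =>
    intro P Q f x
    exact ih (P := P.shift) (Q := Q.shift)
      ⟨fun n => f.toFun (n + 1), fun k i x => f.map_face k i.succ x⟩ x

theorem sharpFun_face {n m : ℕ} (w : CubeCell n (m + 1)) (k : Bool) (i : Fin (m + 1))
    (P : PrecubicalSet.{u}) (x : P.cell n) :
    sharpFun (CubeCell.face k i w) P x = P.face k i (sharpFun w P x) := by
  induction n generalizing m P with
  | zero => cases w
  | succ n ih =>
    cases w with
    | pt b w =>
      rw [CubeCell.face_pt]
      exact ih w i P _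
    | edge w =>
      refine Fin.cases ?_ (fun i' => ?_) i
      · rw [CubeCell.face_zero_edge]
        exact (sharpFun_naturality w (P := P.shift) (Q := P)
          ⟨fun n => P.face k 0, fun l j y => by
            have h := P.face_face k l 0 j (Fin.zero_le _) y
            rwa [Fin.castSucc_zero] at h⟩ x).symm
      · cases m with
        | zero => exact i'.elim0
        | succ m =>
          rw [CubeCell.face_succ_edge]
          exact ih w i' P.shift x

/-- The morphism `x_♯` from the precubical `n`-cube to `P` that sends `ι_n` to `x`. -/
def sharp (P : PrecubicalSet.{u}) {n : ℕ} (x : P.cell n) : Hom (cube n) P where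
  toFun _ w := sharpFun w P x
  map_face k i w := sharpFun_face w k i P x

theorem sharp_top : ∀ (P : PrecubicalSet.{u}) {n : ℕ} (x : P.cell n),
    (P.sharp x).toFun n (CubeCell.top n) = x := by
  intro P n
  induction n generalizing P with
  | zero => intro x; rfl
  | succ n ih => intro x; exact ih P.shift x

theorem sharpFun_cube_top {n m : ℕ} (w : CubeCell n m) :
    sharpFun w (cube n) (CubeCell.top n) = w := by
  induction w with
  | nil => rfl
  | @pt n m k w ih =>
    have h := sharpFun_naturality w (P := cube n) (Q := cube (n + 1))
      ⟨fun _ w => CubeCell.pt k w, fun l i w => (CubeCell.face_pt l k i w).symm⟩ (CubeCell.top n)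
    rw [ih] at h
    refine Eq.trans ?_ h.symm
    exact congrArg (sharpFun w (cube (n + 1))) (CubeCell.face_zero_edge k (CubeCell.top n))
  | @edge n m w ih =>
    have h := sharpFun_naturality w (P := cube n) (Q := (cube (n + 1)).shift)
      ⟨fun _ w => CubeCell.edge w, fun l i w => (CubeCell.face_succ_edge l i w).symm⟩
      (CubeCell.top n)
    rw [ih] at h
    exact h.symm

/-- `x_♯` is the only morphism sending `ι_n` to `x`. -/
theorem sharp_unique {P : PrecubicalSet.{u}} {n m : ℕ} (f : Hom (cube n) P) (w : CubeCell n m) :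
    f.toFun m w = (P.sharp (f.toFun n (CubeCell.top n))).toFun m w := by
  have h := sharpFun_naturality w f (CubeCell.top n)
  rwa [sharpFun_cube_top] at h

/-- An element `x` is regular if `x_♯` is injective. -/
def IsRegular (P : PrecubicalSet.{u}) {n : ℕ} (x : P.cell n) : Prop :=
  ∀ m : ℕ, Function.Injective ((P.sharp x).toFun m)

/-! ### Precubical subsets, stars, free faces -/

/-- A precubical subset: a graded subset that is closed under the face operators. -/
@[ext]
structure Sub (P : PrecubicalSet.{u}) where
  cells (n : ℕ) : Set (P.cell n)
  face_mem {n : ℕ} (k : Bool) (i : Fin (n + 1)) {x : P.cell (n + 1)} :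
    x ∈ cells (n + 1) → P.face k i x ∈ cells n

instance (P : PrecubicalSet.{u}) : LE P.Sub where
  le X Y := ∀ n, X.cells n ⊆ Y.cells n

/-- A precubical subset as a precubical set. -/
def Sub.toPrecubicalSet {P : PrecubicalSet.{u}} (X : P.Sub) : PrecubicalSet.{u} where
  cell n := X.cells n
  face k i x := ⟨P.face k i x.1, X.face_mem k i x.2⟩
  face_face k l i j hij x := Subtype.ext (P.face_face k l i j hij x.1)

/-- The inclusion of a precubical subset. -/
def Sub.incl {P : PrecubicalSet.{u}} (X : P.Sub) : Hom X.toPrecubicalSet P where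
  toFun _ x := x.1
  map_face _ _ _ := rfl

/-- The inclusion of a precubical subset into a larger one. -/
def Sub.inclusion {P : PrecubicalSet.{u}} {X Y : P.Sub} (h : X ≤ Y) :
    Hom X.toPrecubicalSet Y.toPrecubicalSet where
  toFun n x := ⟨x.1, h n x.2⟩
  map_face _ _ _ := rfl

/-- `star(x) = {y ∈ P : x ∈ y_♯(cube)}`. -/
def star (P : PrecubicalSet.{u}) (x : P.Elem) : Set P.Elem :=
  {y | ∃ w : CubeCell y.1 x.1, (P.sharp y.2).toFun x.1 w = x.2}

/-- The precubical subset `P ∖ star(x)`. -/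
def compStar (P : PrecubicalSet.{u}) (x : P.Elem) : P.Sub where
  cells n := {y | (⟨n, y⟩ : P.Elem) ∉ P.star x}
  face_mem {n} k i y hy := by
    rintro ⟨w, hw⟩
    refine hy ⟨((cube (n + 1)).sharp ((cube (n + 1)).face k i (CubeCell.top (n + 1)))).toFun _ w, ?_⟩
    refine (sharpFun_naturality w (P.sharp y) ((cube (n + 1)).face k i
      (CubeCell.top (n + 1)))).trans ?_
    refine Eq.trans (congrArg (sharpFun w P) ?_) hw
    exact ((P.sharp y).map_face k i (CubeCell.top (n + 1))).trans
      (congrArg (P.face k i) (P.sharp_top y))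

/-- The face `d^k_i x` of `x` is free if `star(d^k_i x) = {x, d^k_i x}`. -/
def IsFreeFace (P : PrecubicalSet.{u}) {n : ℕ} (k : Bool) (i : Fin (n + 1))
    (x : P.cell (n + 1)) : Prop :=
  P.star ⟨n, P.face k i x⟩ = {⟨n + 1, x⟩, ⟨n, P.face k i x⟩}

/-! ### Paths and accessibility -/

/-- The elements of the precubical interval with vertices `0, …, l`: there are `l + 1` vertices,
and the edge number `j` is the edge from `j` to `j + 1`. -/
def intervalCell (l : ℕ) : ℕ → Type
  | 0 => Fin (l + 1)
  | 1 => Fin l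
  | _ + 2 => Empty

/-- The precubical interval with vertices `0, …, l`. -/
def interval (l : ℕ) : PrecubicalSet.{0} where
  cell := intervalCell l
  face {n} k _ := match n with
    | 0 => fun j : Fin l => (if k then j.succ else j.castSucc : Fin (l + 1))
    | _ + 1 => fun j : Empty => j.elim
  face_face _ _ _ _ _ x := Empty.elim x

/-- A path of length `l` in `P`. -/
abbrev Path (P : PrecubicalSet.{u}) (l : ℕ) : Type u := Hom (interval l) P

/-- The vertex `ω(j)` of a path. -/
def Path.vertex {P : PrecubicalSet.{u}} {l : ℕ} (ω : P.Path l) (j : Fin (l + 1)) : P.cell 0 :=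
  ω.toFun 0 j

/-- `v →_P w`: there is a path in `P` from `v` to `w`. -/
def Accessible (P : PrecubicalSet.{u}) (v w : P.cell 0) : Prop :=
  ∃ (l : ℕ) (ω : P.Path l), Path.vertex ω 0 = v ∧ Path.vertex ω (Fin.last l) = w

/-- `v →_Q w` for vertices `v`, `w` of `P` and a precubical subset `Q`: the vertices lie in `Q`,
and there is a path in `Q` from `v` to `w`. -/
def Sub.Accessible {P : PrecubicalSet.{u}} (Q : P.Sub) (v w : P.cell 0) : Prop :=
  ∃ (hv : v ∈ Q.cells 0) (hw : w ∈ Q.cells 0), Q.toPrecubicalSet.Accessible ⟨v, hv⟩ ⟨w, hw⟩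

/-- The vertex `d^k_1 ⋯ d^k_1 x`: the initial vertex of `x` for `k = 0` and the final vertex of
`x` for `k = 1`. -/
def corner (P : PrecubicalSet.{u}) (k : Bool) : {n : ℕ} → P.cell n → P.cell 0
  | 0, x => x
  | _ + 1, x => corner P k (P.face k 0 x)

/-! ### Geometric realization -/

/-- The coproduct of the cubes `{x} × [0,1]^{deg x}`, with the coproduct topology. -/
abbrev PreRealization (P : PrecubicalSet.{u}) : Type u :=
  Σ x : P.Elem, (Fin x.1 → unitInterval)

/-- `(d^k_i x, u) ∼ (x, δ^k_i(u))`, where `δ^k_i` inserts the coordinate `k` at the place `i`. -/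
inductive GlueRel (P : PrecubicalSet.{u}) : P.PreRealization → P.PreRealization → Prop
  | glue {n : ℕ} (k : Bool) (i : Fin (n + 1)) (x : P.cell (n + 1)) (t : Fin n → unitInterval) :
    GlueRel P ⟨⟨n, P.face k i x⟩, t⟩
      ⟨⟨n + 1, x⟩, i.insertNth (if k then 1 else 0 : unitInterval) t⟩

/-- The geometric realization `|P|`, with the quotient topology. -/
def Realization (P : PrecubicalSet.{u}) : Type u := Quot P.GlueRel

instance (P : PrecubicalSet.{u}) : TopologicalSpace P.Realization :=
  inferInstanceAs (TopologicalSpace (Quot P.GlueRel))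

/-- The map `|f| : |P| → |Q|` induced by a morphism. -/
def Hom.realization {P Q : PrecubicalSet.{u}} (f : Hom P Q) : C(P.Realization, Q.Realization) where
  toFun := Quot.map (fun p => ⟨⟨p.1.1, f.toFun p.1.1 p.1.2⟩, p.2⟩) (by
    rintro _ _ ⟨k, i, x, t⟩
    dsimp only
    rw [f.map_face]
    exact GlueRel.glue k i (f.toFun _ x) t)
  continuous_toFun := by
    refine continuous_quot_lift _ (continuous_quot_mk.comp ?_)
    refine continuous_sigma fun x => ?_
    exact continuous_sigmaMk (σ := fun x : Q.Elem => (Fin x.1 → unitInterval))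
      (i := (⟨x.1, f.toFun x.1 x.2⟩ : Q.Elem))

/-- A continuous map is a homotopy equivalence if it has a homotopy inverse. -/
def IsHomotopyEquivalence {X Y : Type*} [TopologicalSpace X] [TopologicalSpace Y]
    (f : C(X, Y)) : Prop :=
  ∃ e : ContinuousMap.HomotopyEquiv X Y, e.toFun = f

/-- `C` is deformable into `C'` if there is a precubical subset `D` containing both such that the
inclusion `|C'| → |D|` is a homotopy equivalence. -/
def Sub.DeformableInto {P : PrecubicalSet.{u}} (C C' : P.Sub) : Prop :=
  ∃ (D : P.Sub) (_ : C ≤ D) (h : C' ≤ D), IsHomotopyEquivalence (Sub.inclusion h).realization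

/-! ### Homology and the pointing relation -/

/-- Singular homology `H_*(X)` with coefficients in `R`, the direct sum of all `H_n(X)`. -/
noncomputable abbrev SingularHomology (R : Type v) [CommRing R] (X : Type u)
    [TopologicalSpace X] : Type (max u v) :=
  ⨁ n : ℕ, (((singularHomologyFunctor.{u} (ModuleCat.{max u v} R) n).obj
    (ModuleCat.of R (ULift.{u} R))).obj (TopCat.of X) : ModuleCat.{max u v} R)

/-- The homomorphism of degree `0` that a continuous map induces in homology. -/
noncomputable def homologyMap (R : Type v) [CommRing R] {X Y : Type u} [TopologicalSpace X]
    [TopologicalSpace Y] (f : C(X, Y)) : SingularHomology R X →ₗ[R] SingularHomology R Y :=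
  DirectSum.lmap fun n : ℕ => (((singularHomologyFunctor.{u} (ModuleCat.{max u v} R) n).obj
    (ModuleCat.of R (ULift.{u} R))).map (TopCat.ofHom f)).hom

/-- The pointing relation `α ↗ β` on `H_*(|P|)`, that is, the edges of the homology graph. -/
def PointsTo (R : Type v) [CommRing R] (P : PrecubicalSet.{u})
    (α β : SingularHomology R P.Realization) : Prop :=
  ∃ X Y : P.Sub, α ∈ LinearMap.range (homologyMap R X.incl.realization) ∧
    β ∈ LinearMap.range (homologyMap R Y.incl.realization) ∧
    ∀ x ∈ X.cells 0, ∀ y ∈ Y.cells 0, P.Accessible x y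

end PrecubicalSet

namespace PrecubicalSet

/-! ### Functoriality and homotopy invariance of homology -/

section Homology

variable (R : Type v) [CommRing R] {X Y Z : Type u} [TopologicalSpace X] [TopologicalSpace Y]
  [TopologicalSpace Z]

/-! As the face is free, `Q` lacks only `x` and `d^k_i x`; by regularity, no other face of `x`
coincides with this one. So `|P|` is `|Q|` with a cube glued on along an open box (all faces of the
cube but one). Projecting the cube radially onto the box makes `|Q|` a deformation retract of `|P|`
(`IsElementaryCollapse.isHomotopyEquivalence`), whence `ι_*` is bijective. Pointing is preserved
from `Q` to `P` because morphisms map paths to paths (`PointsTo.map`).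

For the converse, let `X`, `Y` witness a pointing in `P`. Say `k = 0`; for `k = 1` all paths are
reversed and `X`, `Y` exchange roles, which is why `Reaches` carries a direction, always taken to be
`!k`. The set `X` is pushed into `Q` by adding all faces of `x`, if it contains the free face, and
then collapsing (`IsElementaryCollapse.exists_hom`). The set `Y` is deformed into some `C'` by
hypothesis. A path of `P` leaves `Q` only through the free face, which then is an edge; its start,
like every vertex of `x`, is joined within `Q` to the final vertex of `x` (`reaches_corner`,
`reaches_or`). From there, the hypothesis on `C'` supplies the rest of the path
(`reaches_of_reaches`). -/

theorem homologyMap_comp (g : C(Y, Z)) (f : C(X, Y)) :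
    homologyMap R (g.comp f) = homologyMap R g ∘ₗ homologyMap R f := by
  unfold homologyMap
  rw [← DirectSum.lmap_comp]
  congr 1
  funext n
  rw [← ModuleCat.hom_comp, ← Functor.map_comp]
  rfl

theorem homologyMap_id : homologyMap R (ContinuousMap.id X) = LinearMap.id := by
  unfold homologyMap
  rw [← DirectSum.lmap_id]
  congr 1
  funext n
  rw [← ModuleCat.hom_id, ← CategoryTheory.Functor.map_id]
  rfl

theorem homologyMap_eq_of_homotopic {f g : C(X, Y)} (h : f.Homotopic g) :
    homologyMap R f = homologyMap R g := by
  obtain ⟨H⟩ := h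
  unfold homologyMap
  congr 1
  funext n
  congr 1
  exact TopCat.Homotopy.congr_homologyMap_singularChainComplexFunctor
    (f := TopCat.ofHom f) (g := TopCat.ofHom g) H _ n

theorem IsHomotopyEquivalence.bijective_homologyMap {f : C(X, Y)} (hf : IsHomotopyEquivalence f) :
    Function.Bijective (homologyMap R f) := by
  obtain ⟨e, rfl⟩ := hf
  have h₁ := homologyMap_eq_of_homotopic R e.left_inv
  have h₂ := homologyMap_eq_of_homotopic R e.right_inv
  rw [homologyMap_comp, homologyMap_id] at h₁ h₂
  exact Function.bijective_iff_has_inverse.2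
    ⟨homologyMap R e.invFun, fun a => LinearMap.congr_fun h₁ a, fun a => LinearMap.congr_fun h₂ a⟩

end Homology

/-! ### Morphisms and their realizations -/

/-- The composite of two morphisms. -/
def Hom.comp {A B D : PrecubicalSet.{u}} (g : Hom B D) (f : Hom A B) : Hom A D where
  toFun n x := g.toFun n (f.toFun n x)
  map_face k i x := by rw [f.map_face, g.map_face]

theorem Hom.realization_comp {A B D : PrecubicalSet.{u}} (g : Hom B D) (f : Hom A B) :
    (g.comp f).realization = g.realization.comp f.realization := by
  ext p
  induction p using Quot.ind
  rfl

theorem Hom.range_homologyMap_comp_le (R : Type v) [CommRing R] {A B D : PrecubicalSet.{u}}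
    (g : Hom B D) (f : Hom A B) : LinearMap.range (homologyMap R (g.comp f).realization) ≤
      LinearMap.range (homologyMap R g.realization) := by
  rw [Hom.realization_comp, homologyMap_comp]
  exact LinearMap.range_comp_le_range _ _

/-- The image of a morphism. -/
def Hom.range {A B : PrecubicalSet.{u}} (f : Hom A B) : B.Sub where
  cells n := Set.range (f.toFun n)
  face_mem := by
    rintro n k i _ ⟨a, rfl⟩
    exact ⟨_, f.map_face k i a⟩

/-- A morphism, regarded as a morphism to its image. -/
def Hom.toRange {A B : PrecubicalSet.{u}} (f : Hom A B) : Hom A f.range.toPrecubicalSet where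
  toFun n a := ⟨f.toFun n a, a, rfl⟩
  map_face k i a := Subtype.ext (f.map_face k i a)

/-- Witnesses may be arbitrary morphisms, since they factor through their images. This avoids
transporting precubical subsets of subsets. -/
theorem PointsTo.of_hom {R : Type v} [CommRing R] {A B P : PrecubicalSet.{u}} (f : Hom A P)
    (g : Hom B P) {α β : SingularHomology R P.Realization}
    (hα : α ∈ LinearMap.range (homologyMap R f.realization))
    (hβ : β ∈ LinearMap.range (homologyMap R g.realization))
    (h : ∀ a b, P.Accessible (f.toFun 0 a) (g.toFun 0 b)) : PointsTo R P α β := by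
  refine ⟨f.range, g.range, Hom.range_homologyMap_comp_le R _ f.toRange hα,
    Hom.range_homologyMap_comp_le R _ g.toRange hβ, ?_⟩
  rintro _ ⟨a, rfl⟩ _ ⟨b, rfl⟩
  exact h a b

/-- The point of `|P|` with coordinates `t` in the cube `y`. -/
def mkPt (P : PrecubicalSet.{u}) {n : ℕ} (y : P.cell n) (t : Fin n → unitInterval) :
    P.Realization :=
  Quot.mk _ ⟨⟨n, y⟩, t⟩

/-- The vertex `k` of the unit interval. -/
def endpoint (k : Bool) : unitInterval := if k then 1 else 0

theorem mkPt_face (P : PrecubicalSet.{u}) {n : ℕ} (k : Bool) (i : Fin (n + 1))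
    (y : P.cell (n + 1)) (t : Fin n → unitInterval) :
    P.mkPt (P.face k i y) t = P.mkPt y (i.insertNth (endpoint k) t) :=
  Quot.sound (GlueRel.glue k i y t)

theorem continuous_mkPt (P : PrecubicalSet.{u}) {n : ℕ} (y : P.cell n) : Continuous (P.mkPt y) :=
  continuous_quot_mk.comp
    (continuous_sigmaMk (σ := fun x : P.Elem => (Fin x.1 → unitInterval)) (i := ⟨n, y⟩))

/-- Maps out of `|P|` are compatible families of maps out of its cubes. -/
def liftRealization {P : PrecubicalSet.{u}} {Z : Type*} [TopologicalSpace Z]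
    (φ : ∀ e : P.Elem, C(Fin e.1 → unitInterval, Z))
    (h : ∀ (n : ℕ) (k : Bool) (i : Fin (n + 1)) (y : P.cell (n + 1)) (t : Fin n → unitInterval),
      φ ⟨n, P.face k i y⟩ t = φ ⟨n + 1, y⟩ (i.insertNth (endpoint k) t)) :
    C(P.Realization, Z) where
  toFun := Quot.lift (fun p => φ p.1 p.2) (by
    rintro _ _ ⟨k, i, x, t⟩
    exact h _ k i x t)
  continuous_toFun := continuous_quot_lift _ (continuous_sigma fun e => (φ e).continuous)

theorem realization_ext {P : PrecubicalSet.{u}} {Z : Type*} [TopologicalSpace Z]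
    {f g : C(P.Realization, Z)}
    (h : ∀ (n : ℕ) (y : P.cell n) (t : Fin n → unitInterval), f (P.mkPt y t) = g (P.mkPt y t)) :
    f = g := by
  ext p
  induction p using Quot.ind with
  | mk p => exact h _ _ _

/-! ### Exchanging two faces -/

/-- The precubical identity without an order condition on the indices;
`insertNth_insertNth_succAbove` is its counterpart for coordinates, with the same reindexing. -/
theorem face_face_succAbove (P : PrecubicalSet.{u}) {n : ℕ} (k l : Bool) (i : Fin (n + 2))
    (j : Fin (n + 1)) (y : P.cell (n + 2)) :
    P.face l j (P.face k i y) = P.face k (j.predAbove i) (P.face l (i.succAbove j) y) := by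
  rcases Fin.lt_or_le j.castSucc i with h | h
  · rw [Fin.succAbove_of_castSucc_lt _ _ h, Fin.predAbove_of_castSucc_lt _ _ h]
    have := P.face_face l k j (i.pred (Fin.ne_zero_of_lt h)) (by
      rw [Fin.lt_def] at h
      rw [Fin.le_def]
      simp at h ⊢
      omega) y
    rwa [Fin.succ_pred] at this
  · rw [Fin.succAbove_of_le_castSucc _ _ h, Fin.predAbove_of_le_castSucc _ _ h]
    have := P.face_face k l (i.castPred (Fin.ne_last_of_lt (h.trans_lt
      (Fin.castSucc_lt_last j)))) j (by
      rw [Fin.le_def] at h ⊢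
      simpa using h) y
    rw [Fin.castSucc_castPred] at this
    exact this.symm

theorem insertNth_insertNth_succAbove {T : Type*} {n : ℕ} (a b : T) (i : Fin (n + 2))
    (j : Fin (n + 1)) (t : Fin n → T) :
    i.insertNth (α := fun _ => T) a (j.insertNth (α := fun _ => T) b t) =
      (i.succAbove j).insertNth (α := fun _ => T) b
        ((j.predAbove i).insertNth (α := fun _ => T) a t) := by
  set s := i.insertNth (α := fun _ => T) a (j.insertNth (α := fun _ => T) b t) with hs
  rw [Fin.eq_insertNth_iff, Fin.eq_insertNth_iff]
  refine ⟨?_, ?_, ?_⟩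
  · simp [hs]
  · simp [hs, Fin.removeNth, Fin.succAbove_succAbove_predAbove]
  · rw [← Fin.removeNth_removeNth_eq_swap]
    simp [hs]

/-! ### The deformation of a cube onto an open box -/

section Box

variable {n : ℕ} (k : Bool) (i : Fin (n + 1))

/-- The coordinates of a point outside the cube, in front of the centre of the face `(k, i)`. -/
noncomputable def boxCenter (j : Fin (n + 1)) : ℝ :=
  if j = i then (if k then 2 else -1) else 1 / 2

/-- The inverse distances of `boxCenter` from the hyperplanes spanned by the faces. -/
noncomputable def boxScale (j : Fin (n + 1)) : ℝ := if j = i then 1 / 2 else 2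

/-- The position of a point of the cube relative to `boxCenter`. -/
noncomputable def boxVector (u : Fin (n + 1) → unitInterval) (j : Fin (n + 1)) : ℝ :=
  ((u j : ℝ) - boxCenter k i j) * boxScale i j

theorem continuous_boxVector : Continuous (boxVector k i) := by
  unfold boxVector
  fun_prop

theorem norm_boxVector_pos (u : Fin (n + 1) → unitInterval) : 0 < ‖boxVector k i u‖ := by
  refine lt_of_lt_of_le ?_ (norm_le_pi_norm _ i)
  rw [norm_pos_iff]
  have h0 := (u i).2.1
  have h1 := (u i).2.2
  unfold boxVector boxCenter boxScale
  cases k <;> simp <;> intro h <;> linarith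

/-- The points of norm at most one form a box around `boxCenter` that contains the cube. The scale
`1/2` is the inverse of the distance 2 to the face opposite to `(k, i)`, and 2 is the inverse of the
distance `1/2` to the lateral faces. -/
theorem norm_boxVector_le (u : Fin (n + 1) → unitInterval) : ‖boxVector k i u‖ ≤ 1 := by
  refine (pi_norm_le_iff_of_nonneg zero_le_one).2 fun j => ?_
  have h0 := (u j).2.1
  have h1 := (u j).2.2
  rw [Real.norm_eq_abs, abs_le]
  unfold boxVector boxCenter boxScale
  split_ifs <;> constructor <;> linarith

/-- The open box lies on the unit sphere of the rescaled sup norm, so that dividing by the norm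
fixes it pointwise. -/
theorem norm_boxVector_eq_one {u : Fin (n + 1) → unitInterval} {l : Bool} {j : Fin (n + 1)}
    (h : (l, j) ≠ (k, i)) (hu : u j = endpoint l) : ‖boxVector k i u‖ = 1 := by
  refine le_antisymm (norm_boxVector_le k i u) (le_trans (le_of_eq ?_) (norm_le_pi_norm _ j))
  rw [Real.norm_eq_abs]
  unfold boxVector boxCenter boxScale
  rw [hu]
  by_cases hj : j = i
  · subst hj
    cases k <;> cases l <;> simp [endpoint] at h ⊢; norm_num [abs_of_neg]
  · cases l <;> simp [endpoint, hj]; norm_num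

/-- The projection of the cube onto the open box opposite to the face `(k, i)`. -/
noncomputable def boxProj : C(Fin (n + 1) → unitInterval, Fin (n + 1) → unitInterval) where
  toFun u j := Set.projIcc 0 1 zero_le_one
    (boxCenter k i j + ((u j : ℝ) - boxCenter k i j) / ‖boxVector k i u‖)
  continuous_toFun := by
    refine continuous_pi fun j => continuous_projIcc.comp ?_
    have h := (continuous_boxVector k i).norm
    exact continuous_const.add ((Continuous.sub (by fun_prop) continuous_const).div h
      fun u => (norm_boxVector_pos k i u).ne')

theorem boxProj_eq_self {u : Fin (n + 1) → unitInterval} {l : Bool} {j : Fin (n + 1)}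
    (h : (l, j) ≠ (k, i)) (hu : u j = endpoint l) : boxProj k i u = u := by
  funext j'
  change Set.projIcc 0 1 zero_le_one _ = _
  rw [norm_boxVector_eq_one k i h hu, div_one, add_sub_cancel]
  exact Set.projIcc_val _ _

/-- A coordinate where the sup norm is attained is sent to an end of the interval. In direction `i`
this can only be the end opposite to `k`, because the centre lies beyond the face `(k, i)`. -/
theorem exists_boxProj_eq (u : Fin (n + 1) → unitInterval) :
    ∃ (l : Bool) (j : Fin (n + 1)), (l, j) ≠ (k, i) ∧ boxProj k i u j = endpoint l := by
  obtain ⟨j, hj⟩ : ∃ j, ‖boxVector k i u j‖ = ‖boxVector k i u‖ := by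
    by_contra! hne
    exact lt_irrefl _ ((pi_norm_lt_iff (norm_boxVector_pos k i u)).2
      fun j => lt_of_le_of_ne (norm_le_pi_norm _ j) (hne j))
  have hpos := norm_boxVector_pos k i u
  have hval : boxProj k i u j = Set.projIcc (0 : ℝ) 1 zero_le_one
    (boxCenter k i j + ((u j : ℝ) - boxCenter k i j) / ‖boxVector k i u‖) := rfl
  set g := ‖boxVector k i u‖
  have h0 := (u j).2.1
  have h1 := (u j).2.2
  rw [Real.norm_eq_abs] at hj
  unfold boxVector at hj
  by_cases hji : j = i
  · refine ⟨!k, j, by simp, ?_⟩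
    cases k
    · have hu : (u j : ℝ) - -1 = 2 * g := by
        simp only [boxCenter, boxScale, hji, if_true, Bool.false_eq_true, if_false] at hj
        rw [hji] at h0 h1 ⊢
        rw [abs_of_nonneg (by linarith)] at hj
        linarith
      rw [hval]
      simp only [boxCenter, hji, if_true, Bool.false_eq_true, if_false]
      rw [hji] at hu
      rw [hu, mul_div_cancel_right₀ _ hpos.ne']
      exact Set.projIcc_of_right_le _ (by norm_num)
    · have hu : (u j : ℝ) - 2 = (-2) * g := by
        simp only [boxCenter, boxScale, hji, if_true] at hj
        rw [hji] at h0 h1 ⊢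
        rw [abs_of_nonpos (by linarith)] at hj
        linarith
      rw [hval]
      simp only [boxCenter, hji, if_true]
      rw [hji] at hu
      rw [hu, mul_div_cancel_right₀ _ hpos.ne']
      exact Set.projIcc_of_le_left _ (by norm_num)
  · simp only [boxCenter, boxScale, hji, if_false] at hj hval
    rcases abs_choice (((u j : ℝ) - 1 / 2) * 2) with hs | hs
    · refine ⟨true, j, by simp [hji], ?_⟩
      have hu : (u j : ℝ) - 1 / 2 = 1 / 2 * g := by linarith
      rw [hval, hu, mul_div_cancel_right₀ _ hpos.ne']
      exact Set.projIcc_of_right_le _ (by norm_num)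
    · refine ⟨false, j, by simp [hji], ?_⟩
      have hu : (u j : ℝ) - 1 / 2 = (-(1 / 2)) * g := by linarith
      rw [hval, hu, mul_div_cancel_right₀ _ hpos.ne']
      exact Set.projIcc_of_le_left _ (by norm_num)

/-- The linear homotopy from the identity of the cube to `boxProj`. -/
noncomputable def boxHomotopy :
    C((Fin (n + 1) → unitInterval) × unitInterval, Fin (n + 1) → unitInterval) where
  toFun p j := Set.projIcc 0 1 zero_le_one
    ((p.1 j : ℝ) + (p.2 : ℝ) * ((boxProj k i p.1 j : ℝ) - p.1 j))
  continuous_toFun := by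
    refine continuous_pi fun j => continuous_projIcc.comp ?_
    generalize boxProj k i = f
    fun_prop

theorem boxHomotopy_zero (u : Fin (n + 1) → unitInterval) : boxHomotopy k i (u, 0) = u := by
  funext j
  change Set.projIcc 0 1 zero_le_one ((u j : ℝ) + 0 * _) = _
  rw [zero_mul, add_zero]
  exact Set.projIcc_val _ _

theorem boxHomotopy_one (u : Fin (n + 1) → unitInterval) :
    boxHomotopy k i (u, 1) = boxProj k i u := by
  funext j
  change Set.projIcc 0 1 zero_le_one ((u j : ℝ) + 1 * _) = _
  rw [one_mul, add_sub_cancel]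
  exact Set.projIcc_val _ _

theorem boxHomotopy_eq_self {u : Fin (n + 1) → unitInterval} {l : Bool} {j : Fin (n + 1)}
    (h : (l, j) ≠ (k, i)) (hu : u j = endpoint l) (s : unitInterval) :
    boxHomotopy k i (u, s) = u := by
  funext j'
  change Set.projIcc 0 1 zero_le_one ((u j' : ℝ) + (s : ℝ) * ((boxProj k i u j' : ℝ) - u j')) = _
  rw [boxProj_eq_self k i h hu, sub_self, mul_zero, add_zero]
  exact Set.projIcc_val _ _

end Box

/-! ### Elementary collapses -/

/-- `P` collapses to `Q`: exactly `x` and its face `d^k_i x` are missing in `Q`, and no other face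
of `x` coincides with this one. -/
structure IsElementaryCollapse {P : PrecubicalSet.{u}} (Q : P.Sub) {n : ℕ} (k : Bool)
    (i : Fin (n + 1)) (x : P.cell (n + 1)) : Prop where
  notMem_iff (m : ℕ) (y : P.cell m) : y ∉ Q.cells m ↔
    (⟨m, y⟩ : P.Elem) = ⟨n + 1, x⟩ ∨ (⟨m, y⟩ : P.Elem) = ⟨n, P.face k i x⟩
  eq_of_face_eq (l : Bool) (j : Fin (n + 1)) : P.face l j x = P.face k i x → (l, j) = (k, i)

namespace IsElementaryCollapse

variable {P : PrecubicalSet.{u}} {Q : P.Sub} {n : ℕ} {k : Bool} {i : Fin (n + 1)}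
  {x : P.cell (n + 1)}

theorem mem_of_ne (hc : IsElementaryCollapse Q k i x) {m : ℕ} (h₁ : m ≠ n + 1) (h₂ : m ≠ n)
    (y : P.cell m) : y ∈ Q.cells m := by
  by_contra hy
  rcases (hc.notMem_iff _ _).1 hy with h | h
  · exact h₁ (congrArg Sigma.fst h)
  · exact h₂ (congrArg Sigma.fst h)

theorem face_mem (hc : IsElementaryCollapse Q k i x) {l : Bool} {j : Fin (n + 1)}
    (h : (l, j) ≠ (k, i)) : P.face l j x ∈ Q.cells n := by
  by_contra hy
  rcases (hc.notMem_iff _ _).1 hy with h' | h'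
  · exact absurd (congrArg Sigma.fst h') (by simp)
  · exact h (hc.eq_of_face_eq l j (eq_of_heq (Sigma.mk.inj h').2))

/-- `|P|` is obtained by attaching the cube `x` to `|Q|` along an open box. -/
theorem exists_extension (hc : IsElementaryCollapse Q k i x) {Z : Type*} [TopologicalSpace Z]
    (f : C(Q.toPrecubicalSet.Realization, Z)) (F : C(Fin (n + 1) → unitInterval, Z))
    (hF : ∀ (l : Bool) (j : Fin (n + 1)) (h : (l, j) ≠ (k, i)) (t : Fin n → unitInterval),
      F (j.insertNth (endpoint l) t) =
        f (Q.toPrecubicalSet.mkPt ⟨P.face l j x, hc.face_mem h⟩ t)) :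
    ∃ G : C(P.Realization, Z),
      (∀ p, G (Q.incl.realization p) = f p) ∧ ∀ t, G (P.mkPt x t) = F t := by
  classical
  set δ : C(Fin n → unitInterval, Fin (n + 1) → unitInterval) :=
    ⟨fun t => i.insertNth (endpoint k) t, by fun_prop⟩ with hδ
  -- The constant map is a dummy value: outside `Q` there are only `x` and its free face, and the
  -- updates in `φ` overwrite both.
  set φ₀ : ∀ e : P.Elem, C(Fin e.1 → unitInterval, Z) := fun e =>
    if h : e.2 ∈ Q.cells e.1 then
      f.comp ⟨Q.toPrecubicalSet.mkPt ⟨e.2, h⟩, continuous_mkPt _ _⟩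
    else ContinuousMap.const _ (F fun _ => 0) with hφ₀
  set φ := Function.update (Function.update φ₀ ⟨n + 1, x⟩ F) ⟨n, P.face k i x⟩ (F.comp δ) with hφ
  have hne : (⟨n + 1, x⟩ : P.Elem) ≠ ⟨n, P.face k i x⟩ := fun h =>
    absurd (congrArg Sigma.fst h) (by simp)
  have hφx : φ ⟨n + 1, x⟩ = F := by
    rw [hφ, Function.update_of_ne hne, Function.update_self]
  have hφd : φ ⟨n, P.face k i x⟩ = F.comp δ := Function.update_self ..
  have hφQ : ∀ {m : ℕ} (y : P.cell m) (hy : y ∈ Q.cells m) (t : Fin m → unitInterval),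
      φ ⟨m, y⟩ t = f (Q.toPrecubicalSet.mkPt ⟨y, hy⟩ t) := by
    intro m y hy t
    have h := not_or.1 fun h => (hc.notMem_iff m y).2 h hy
    rw [hφ, Function.update_of_ne h.2, Function.update_of_ne h.1, hφ₀]
    simp only [hy, dif_pos]
    rfl
  have hcompat : ∀ (m : ℕ) (l : Bool) (j : Fin (m + 1)) (y : P.cell (m + 1))
      (t : Fin m → unitInterval),
      φ ⟨m, P.face l j y⟩ t = φ ⟨m + 1, y⟩ (j.insertNth (endpoint l) t) := by
    intro m l j y t
    by_cases hy : y ∈ Q.cells (m + 1)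
    · rw [hφQ _ (Q.face_mem l j hy), hφQ _ hy]
      exact congrArg f (mkPt_face Q.toPrecubicalSet l j ⟨y, hy⟩ t)
    rcases (hc.notMem_iff _ _).1 hy with h | h
    · obtain rfl : m = n := by simpa using congrArg Sigma.fst h
      obtain rfl : y = x := eq_of_heq (Sigma.mk.inj h).2
      rw [hφx]
      by_cases hlj : (l, j) = (k, i)
      · obtain ⟨rfl, rfl⟩ := Prod.mk.inj hlj
        rw [hφd]
        rfl
      · rw [hφQ _ (hc.face_mem hlj), hF l j hlj]
    · obtain rfl : m + 1 = n := congrArg Sigma.fst h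
      obtain rfl : y = P.face k i x := eq_of_heq (Sigma.mk.inj h).2
      -- A face of the free face is also a face of another face of `x`, where `hF` applies.
      have hlj : (l, i.succAbove j) ≠ (k, i) := fun h =>
        Fin.succAbove_ne i j (Prod.mk.inj h).2
      have hQ := hc.face_mem hlj
      rw [hφd, hφQ _ (hc.mem_of_ne (by omega) (by omega) _)]
      change _ = F (i.insertNth (endpoint k) (j.insertNth (endpoint l) t))
      rw [insertNth_insertNth_succAbove, hF l _ hlj]
      refine congrArg f (Eq.trans ?_ (mkPt_face Q.toPrecubicalSet k (j.predAbove i) ⟨_, hQ⟩ t))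
      congr 1
      exact Subtype.ext (face_face_succAbove P k l i j x)
  refine ⟨liftRealization φ hcompat, ?_, fun t => ?_⟩
  · intro p
    induction p using Quot.ind with
    | mk p => exact hφQ p.1.2.1 p.1.2.2 p.2
  · change φ ⟨n + 1, x⟩ t = _
    rw [hφx]

/-- Maps out of `|P|` are determined by their values on `|Q|` and on the cube `x`. -/
theorem ext_realization (hc : IsElementaryCollapse Q k i x) {Z : Type*} [TopologicalSpace Z]
    {f g : C(P.Realization, Z)} (hQ : ∀ p, f (Q.incl.realization p) = g (Q.incl.realization p))
    (hx : ∀ t, f (P.mkPt x t) = g (P.mkPt x t)) : f = g := by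
  refine realization_ext fun m y t => ?_
  by_cases hy : y ∈ Q.cells m
  · exact hQ (Q.toPrecubicalSet.mkPt ⟨y, hy⟩ t)
  rcases (hc.notMem_iff _ _).1 hy with h | h
  · obtain rfl : m = n + 1 := congrArg Sigma.fst h
    obtain rfl : y = x := eq_of_heq (Sigma.mk.inj h).2
    exact hx t
  · obtain rfl : m = n := congrArg Sigma.fst h
    obtain rfl : y = P.face k i x := eq_of_heq (Sigma.mk.inj h).2
    rw [mkPt_face]
    exact hx _

/-- A point on two different faces of the box lies on their common face of codimension two, or the
faces would be opposite and disjoint. The gluing thus takes place inside `|Q|`, and injectivity of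
`|Q| → |P|` is not needed. -/
theorem mkPt_face_eq_of_insertNth_eq (hc : IsElementaryCollapse Q k i x) {l l' : Bool}
    {j j' : Fin (n + 1)} (h : (l, j) ≠ (k, i)) (h' : (l', j') ≠ (k, i))
    {t t' : Fin n → unitInterval}
    (ht : j.insertNth (α := fun _ => unitInterval) (endpoint l) t =
      j'.insertNth (α := fun _ => unitInterval) (endpoint l') t') :
    Q.toPrecubicalSet.mkPt ⟨P.face l j x, hc.face_mem h⟩ t =
      Q.toPrecubicalSet.mkPt ⟨P.face l' j' x, hc.face_mem h'⟩ t' := by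
  by_cases hj : j' = j
  · subst hj
    obtain ⟨hl, rfl⟩ := Fin.insertNth_injective2 ht
    have : l = l' := by
      cases l <;> cases l' <;> simp [endpoint] at hl ⊢
    subst this
    rfl
  · obtain ⟨m, rfl⟩ : ∃ m, n = m + 1 := by
      refine Nat.exists_eq_succ_of_ne_zero ?_
      rintro rfl
      exact hj (Subsingleton.elim (α := Fin 1) _ _)
    obtain ⟨a, rfl⟩ := Fin.exists_succAbove_eq hj
    have hta : t a = endpoint l' := by
      have := congrFun ht (j.succAbove a)
      simpa using this
    obtain ⟨s, rfl⟩ : ∃ s, t = a.insertNth (α := fun _ => unitInterval) (endpoint l') s :=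
      ⟨a.removeNth t, by rw [Fin.eq_insertNth_iff]; exact ⟨hta, rfl⟩⟩
    rw [insertNth_insertNth_succAbove] at ht
    obtain ⟨-, rfl⟩ := Fin.insertNth_injective2 ht
    refine (mkPt_face Q.toPrecubicalSet l' a ⟨P.face l j x, hc.face_mem h⟩ s).symm.trans
      (Eq.trans ?_ (mkPt_face Q.toPrecubicalSet l (a.predAbove j) ⟨_, hc.face_mem h'⟩ s))
    congr 1
    exact Subtype.ext (face_face_succAbove P l l' j a x)

/-- The projection of the cube `x` onto the open box, as a map to `|Q|`. -/
theorem exists_boxMap (hc : IsElementaryCollapse Q k i x) :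
    ∃ B : C(Fin (n + 1) → unitInterval, Q.toPrecubicalSet.Realization),
      ∀ (l : Bool) (j : Fin (n + 1)) (h : (l, j) ≠ (k, i)) (u : Fin (n + 1) → unitInterval),
        boxProj k i u j = endpoint l → B u =
          Q.toPrecubicalSet.mkPt ⟨P.face l j x, hc.face_mem h⟩ (j.removeNth (boxProj k i u)) := by
  choose l j hlj hu using exists_boxProj_eq k i
  set B : (Fin (n + 1) → unitInterval) → Q.toPrecubicalSet.Realization := fun u =>
    Q.toPrecubicalSet.mkPt ⟨P.face (l u) (j u) x, hc.face_mem (hlj u)⟩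
      ((j u).removeNth (boxProj k i u)) with hB
  have key : ∀ (l : Bool) (j : Fin (n + 1)) (h : (l, j) ≠ (k, i))
      (u : Fin (n + 1) → unitInterval), boxProj k i u j = endpoint l → B u =
        Q.toPrecubicalSet.mkPt ⟨P.face l j x, hc.face_mem h⟩ (j.removeNth (boxProj k i u)) := by
    intro l' j' h u hu'
    refine hc.mkPt_face_eq_of_insertNth_eq (hlj u) h ?_
    rw [← hu u, ← hu', Fin.insertNth_self_removeNth, Fin.insertNth_self_removeNth]
  refine ⟨⟨B, ?_⟩, key⟩
  -- Continuity is checked on the finite closed cover by the preimages of the faces of the box.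
  let A : {a : Bool × Fin (n + 1) // a ≠ (k, i)} → Set (Fin (n + 1) → unitInterval) :=
    fun a => {u | boxProj k i u a.1.2 = endpoint a.1.1}
  refine (locallyFinite_of_finite A).continuous ?_ ?_ ?_
  · exact Set.eq_univ_of_forall fun u => Set.mem_iUnion.2 ⟨⟨(l u, j u), hlj u⟩, hu u⟩
  · intro a
    exact isClosed_eq (by fun_prop) continuous_const
  · intro a
    refine ContinuousOn.congr (f := fun u => Q.toPrecubicalSet.mkPt
      ⟨P.face a.1.1 a.1.2 x, hc.face_mem a.2⟩ (a.1.2.removeNth (boxProj k i u))) ?_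
      fun u hu => key _ _ a.2 u hu
    refine Continuous.continuousOn ((continuous_mkPt _ _).comp ?_)
    refine continuous_pi fun b => ?_
    unfold Fin.removeNth
    fun_prop

/-- An elementary collapse induces a homotopy equivalence of the realizations. -/
theorem isHomotopyEquivalence (hc : IsElementaryCollapse Q k i x) :
    IsHomotopyEquivalence Q.incl.realization := by
  obtain ⟨B, hB⟩ := hc.exists_boxMap
  have hQmk : ∀ (l : Bool) (j : Fin (n + 1)) (h : (l, j) ≠ (k, i)) (t : Fin n → unitInterval),
      Q.incl.realization (Q.toPrecubicalSet.mkPt ⟨P.face l j x, hc.face_mem h⟩ t) =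
        P.mkPt x (j.insertNth (endpoint l) t) := fun l j h t => mkPt_face P l j x t
  obtain ⟨r, hrQ, hrx⟩ := hc.exists_extension (ContinuousMap.id _) B (by
    intro l j h t
    have hp := boxProj_eq_self k i (u := j.insertNth (endpoint l) t) h (by simp)
    rw [hB l j h _ (by rw [hp]; simp), hp]
    simp)
  -- The homotopy is built as a map from `|P|` to the space of paths in `|P|`, constant on `|Q|`.
  -- Thus the extension property applies directly, without describing `|P| × [0,1]` as a quotient.
  obtain ⟨H, hHQ, hHx⟩ := hc.exists_extension
    (((⟨fun p => p.1, by fun_prop⟩ : C(P.Realization × unitInterval, P.Realization)).curry).comp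
      Q.incl.realization)
    ((⟨fun p => P.mkPt x (boxHomotopy k i p), (continuous_mkPt P x).comp (by fun_prop)⟩ :
      C((Fin (n + 1) → unitInterval) × unitInterval, P.Realization)).curry) (by
    intro l j h t
    ext s
    exact (congrArg (P.mkPt x) (boxHomotopy_eq_self k i (u := j.insertNth (endpoint l) t) h
      (by simp) s)).trans (hQmk l j h t).symm)
  have hH : ContinuousMap.Homotopic (ContinuousMap.id _) (Q.incl.realization.comp r) := by
    refine ⟨⟨⟨fun p => H p.2 p.1, by fun_prop⟩, fun p => ?_, fun p => ?_⟩⟩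
    · refine DFunLike.congr_fun (hc.ext_realization (f := ⟨fun p => H p 0, by fun_prop⟩)
        (g := ContinuousMap.id _) (fun p => ?_) fun t => ?_) p
      · exact DFunLike.congr_fun (hHQ p) 0
      · refine (DFunLike.congr_fun (hHx t) 0).trans ?_
        exact congrArg (P.mkPt x) (boxHomotopy_zero k i t)
    · refine DFunLike.congr_fun (hc.ext_realization (f := ⟨fun p => H p 1, by fun_prop⟩)
        (g := Q.incl.realization.comp r) (fun p => ?_) fun t => ?_) p
      · refine (DFunLike.congr_fun (hHQ p) 1).trans ?_
        exact congrArg Q.incl.realization (hrQ p).symm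
      · refine (DFunLike.congr_fun (hHx t) 1).trans ?_
        change P.mkPt x (boxHomotopy k i (t, 1)) = Q.incl.realization (r (P.mkPt x t))
        obtain ⟨l, j, h, hu⟩ := exists_boxProj_eq k i t
        rw [hrx, hB l j h t hu, hQmk l j h, boxHomotopy_one, ← hu, Fin.insertNth_self_removeNth]
  refine ⟨⟨Q.incl.realization, r, ?_, hH.symm⟩, rfl⟩
  have : r.comp Q.incl.realization = ContinuousMap.id _ := ContinuousMap.ext hrQ
  rw [this]

end IsElementaryCollapse

/-! ### Iterated faces -/

/-- `z` is an iterated face of `y`. -/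
inductive IsIteratedFace (P : PrecubicalSet.{u}) {m : ℕ} (z : P.cell m) :
    {n : ℕ} → P.cell n → Prop
  | refl : IsIteratedFace P z z
  | of_face {n : ℕ} (k : Bool) (i : Fin (n + 1)) (y : P.cell (n + 1)) :
      IsIteratedFace P z (P.face k i y) → IsIteratedFace P z y

namespace IsIteratedFace

variable {P : PrecubicalSet.{u}}

theorem face {m n : ℕ} {z : P.cell (m + 1)} {y : P.cell n} (h : P.IsIteratedFace z y) (k : Bool)
    (i : Fin (m + 1)) : P.IsIteratedFace (P.face k i z) y := by
  induction h with
  | refl => exact of_face k i z refl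
  | of_face l j y _ ih => exact of_face l j y ih

theorem mem {m n : ℕ} {z : P.cell m} {y : P.cell n} (h : P.IsIteratedFace z y) {Q : P.Sub}
    (hy : y ∈ Q.cells n) : z ∈ Q.cells m := by
  induction h with
  | refl => exact hy
  | of_face l j y _ ih => exact ih (Q.face_mem l j hy)

theorem exists_face {n : ℕ} {v : P.cell 0} {y : P.cell (n + 1)} (h : P.IsIteratedFace v y) :
    ∃ l j, P.IsIteratedFace v (P.face l j y) := by
  cases h with
  | of_face l j _ h => exact ⟨l, j, h⟩

theorem eq_of_vertex {v y : P.cell 0} (h : P.IsIteratedFace v y) : v = y := by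
  cases h
  rfl

/-- A vertex of a cube of degree at least two has a codimension one face containing it that is
different from any given one. -/
theorem exists_face_ne {n : ℕ} {v : P.cell 0} {y : P.cell (n + 2)} (h : P.IsIteratedFace v y)
    (k : Bool) (i : Fin (n + 2)) :
    ∃ l j, (l, j) ≠ (k, i) ∧ P.IsIteratedFace v (P.face l j y) := by
  obtain ⟨l, j, hv⟩ := h.exists_face
  by_cases hlj : (l, j) = (k, i)
  · obtain ⟨rfl, rfl⟩ := Prod.mk.inj hlj
    obtain ⟨l', j', hv'⟩ := hv.exists_face
    -- The vertex lies on a face of codimension two, which is contained in a second face of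
    -- codimension one; this needs degree at least two.
    refine ⟨l', j.succAbove j', fun h => Fin.succAbove_ne j j' (Prod.mk.inj h).2, ?_⟩
    rw [face_face_succAbove] at hv'
    exact of_face _ _ _ hv'
  · exact ⟨l, j, hlj, hv⟩

end IsIteratedFace

/-- The precubical subset of all iterated faces of `x`. -/
def faceClosure (P : PrecubicalSet.{u}) {n : ℕ} (x : P.cell n) : P.Sub where
  cells _ := {z | P.IsIteratedFace z x}
  face_mem k i _ h := IsIteratedFace.face h k i

theorem isIteratedFace_corner {P : PrecubicalSet.{u}} (c : Bool) {n : ℕ} (y : P.cell n) :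
    P.IsIteratedFace (P.corner c y) y := by
  induction n with
  | zero => exact .refl
  | succ n ih => exact .of_face c 0 y (ih _)

theorem corner_face (P : PrecubicalSet.{u}) (c : Bool) {n : ℕ} (j : Fin (n + 1))
    (y : P.cell (n + 1)) : P.corner c (P.face c j y) = P.corner c y := by
  induction n with
  | zero => rw [Subsingleton.elim (α := Fin 1) j 0]; rfl
  | succ n ih =>
    refine Fin.cases rfl (fun j => ?_) j
    change P.corner c (P.face c 0 (P.face c j.succ y)) = P.corner c (P.face c 0 y)
    rw [P.face_face c c 0 j (Fin.zero_le _)]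
    exact ih j _

/-- This is the edge of `y` in direction `j` at the corner `c`. In degree at least two it also lies
in a face of type `c`; for `c = !k` such a face is not the free one, so the edge survives in `Q`. -/
theorem exists_edge_corner (P : PrecubicalSet.{u}) (c : Bool) {n : ℕ} (j : Fin (n + 1))
    (y : P.cell (n + 1)) : ∃ e : P.cell 1, P.IsIteratedFace e y ∧
      (n ≠ 0 → ∃ b, P.IsIteratedFace e (P.face c b y)) ∧
      P.face (!c) 0 e = P.corner c (P.face (!c) j y) ∧ P.face c 0 e = P.corner c y := by
  induction n with
  | zero =>
    refine ⟨y, .refl, fun h => absurd rfl h, ?_, rfl⟩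
    rw [Subsingleton.elim (α := Fin 1) j 0]
    rfl
  | succ n ih =>
    -- Pass to a face of type `c` in a direction other than `j`; there, direction `j` has the index
    -- `Fin.predAbove 0 j`.
    obtain ⟨e, he, -, h₀, h₁⟩ := ih (Fin.predAbove 0 j) (P.face c (j.succAbove 0) y)
    refine ⟨e, .of_face _ _ _ he, fun _ => ⟨_, he⟩, ?_, ?_⟩
    · rw [h₀, ← face_face_succAbove, corner_face]
    · rw [h₁, corner_face]

/-! ### Accessibility in the direction `c` -/

/-- `w` can be reached from `v` along edges in `Q` that are traversed towards their vertices
`d^c_1`. -/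
def Sub.Reaches {P : PrecubicalSet.{u}} (Q : P.Sub) (c : Bool) : P.cell 0 → P.cell 0 → Prop :=
  Relation.ReflTransGen fun v w => ∃ e ∈ Q.cells 1, P.face (!c) 0 e = v ∧ P.face c 0 e = w

/-- The precubical subset consisting of all elements. -/
def Sub.full (P : PrecubicalSet.{u}) : P.Sub where
  cells _ := Set.univ
  face_mem _ _ _ _ := trivial

theorem Sub.Reaches.reverse {P : PrecubicalSet.{u}} {Q : P.Sub} {c : Bool} {v w : P.cell 0}
    (h : Q.Reaches c v w) : Q.Reaches (!c) w v := by
  refine Relation.ReflTransGen.mono ?_ _ _ (Relation.ReflTransGen.swap _ _ h)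
  rintro a b ⟨e, he, h₀, h₁⟩
  exact ⟨e, he, by rwa [Bool.not_not], h₀⟩

/-- Go to the corner of a face that contains `v`; if this face has type `!c`, one further edge leads
to the corner of `y`. -/
theorem Sub.reaches_corner {P : PrecubicalSet.{u}} (Q : P.Sub) (c : Bool) {n : ℕ} {y : P.cell n}
    (hy : y ∈ Q.cells n) {v : P.cell 0} (hv : P.IsIteratedFace v y) :
    Q.Reaches c v (P.corner c y) := by
  induction n with
  | zero =>
    rw [hv.eq_of_vertex]
    exact Relation.ReflTransGen.refl
  | succ n ih =>
    obtain ⟨l, j, hv'⟩ := hv.exists_face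
    have h := ih (Q.face_mem l j hy) hv'
    rcases Bool.eq_or_eq_not l c with rfl | rfl
    · rwa [corner_face] at h
    · obtain ⟨e, he, -, h₀, h₁⟩ := P.exists_edge_corner c j y
      exact h.tail ⟨e, he.mem hy, h₀, h₁⟩

theorem Accessible.cons {P : PrecubicalSet.{u}} (e : P.cell 1) {w : P.cell 0}
    (h : P.Accessible (P.face true 0 e) w) : P.Accessible (P.face false 0 e) w := by
  obtain ⟨l, ω, h₀, h₁⟩ := h
  refine ⟨l + 1, ⟨fun m => match m with
    | 0 => fun j => Fin.cons (α := fun _ : Fin (l + 2) => P.cell 0) (P.face false 0 e) (ω.toFun 0) j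
    | 1 => fun j => Fin.cons (α := fun _ : Fin (l + 1) => P.cell 1) e (ω.toFun 1) j
    | _ + 2 => fun j => Empty.elim j, ?_⟩, rfl, h₁⟩
  rintro (_ | m) k i j
  · obtain rfl : i = 0 := Subsingleton.elim (α := Fin 1) _ _
    refine Fin.cases ?_ (fun j => ?_) j
    · cases k
      · rfl
      · exact h₀
    · have := ω.map_face (n := 0) k 0 j
      cases k <;> exact this
  · exact Empty.elim j

theorem accessible_iff_reaches {P : PrecubicalSet.{u}} {v w : P.cell 0} :
    P.Accessible v w ↔ (Sub.full P).Reaches true v w := by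
  constructor
  · rintro ⟨l, ω, rfl, rfl⟩
    have h : ∀ j : Fin (l + 1), (Sub.full P).Reaches true (ω.vertex 0) (ω.vertex j) := by
      intro j
      induction j using Fin.induction with
      | zero => exact Relation.ReflTransGen.refl
      | succ j ih =>
        exact ih.tail ⟨ω.toFun 1 j, trivial, (ω.map_face (n := 0) false 0 j).symm,
          (ω.map_face (n := 0) true 0 j).symm⟩
    exact h _
  · intro h
    induction h using Relation.ReflTransGen.head_induction_on with
    | refl =>
      refine ⟨0, ⟨fun m => match m with
        | 0 => fun _ => w
        | 1 => fun j : Fin 0 => j.elim0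
        | _ + 2 => fun j => Empty.elim j, ?_⟩, rfl, rfl⟩
      rintro (_ | m) k i j
      · exact Fin.elim0 j
      · exact Empty.elim j
    | head h _ ih =>
      obtain ⟨e, -, rfl, rfl⟩ := h
      exact ih.cons e

theorem Sub.accessible_iff_reaches {P : PrecubicalSet.{u}} {Q : P.Sub} {v w : P.cell 0}
    (hv : v ∈ Q.cells 0) : Q.Accessible v w ↔ Q.Reaches true v w := by
  constructor
  · rintro ⟨_, _, h⟩
    replace h := PrecubicalSet.accessible_iff_reaches.1 h
    refine Relation.ReflTransGen.lift (fun a : Q.toPrecubicalSet.cell 0 => a.1) ?_ _ _ h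
    rintro a b ⟨e, -, rfl, rfl⟩
    exact ⟨e.1, e.2, rfl, rfl⟩
  · intro h
    induction h using Relation.ReflTransGen.head_induction_on with
    | refl =>
      exact ⟨hv, hv, PrecubicalSet.accessible_iff_reaches.2 Relation.ReflTransGen.refl⟩
    | head h _ ih =>
      obtain ⟨e, he, rfl, rfl⟩ := h
      obtain ⟨_, hw, h⟩ := ih (Q.face_mem _ _ he)
      exact ⟨hv, hw, Accessible.cons (P := Q.toPrecubicalSet) ⟨e, he⟩ h⟩

/-! ### Accessibility and elementary collapses -/

namespace IsElementaryCollapse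

variable {P : PrecubicalSet.{u}} {Q : P.Sub} {n : ℕ} {k : Bool} {i : Fin (n + 2)}
  {x : P.cell (n + 2)}

/-- Although `x` is not in `Q`, the route can avoid the free face: it starts in another face
containing `v`, and a last edge, if required, lies in a face of type `!k`. -/
theorem reaches_corner (hc : IsElementaryCollapse Q k i x) {v : P.cell 0}
    (hv : P.IsIteratedFace v x) : Q.Reaches (!k) v (P.corner (!k) x) := by
  obtain ⟨l, j, hlj, hv'⟩ := hv.exists_face_ne k i
  have h := Q.reaches_corner (!k) (hc.face_mem hlj) hv'
  rcases Bool.eq_or_eq_not l (!k) with rfl | rfl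
  · rwa [corner_face] at h
  · obtain ⟨e, -, he, h₀, h₁⟩ := P.exists_edge_corner (!k) j x
    obtain ⟨b, hb⟩ := he (Nat.succ_ne_zero n)
    have hb' : ((!k), b) ≠ (k, i) := fun h => absurd (Prod.mk.inj h).1 (by simp)
    exact h.tail ⟨e, hb.mem (hc.face_mem hb'), h₀, h₁⟩

/-- A path in `P` either may be taken in `Q`, or it passes through the free face. -/
theorem reaches_or (hc : IsElementaryCollapse Q k i x) {v w : P.cell 0}
    (h : (Sub.full P).Reaches (!k) v w) : Q.Reaches (!k) v w ∨
      Q.Reaches (!k) v (P.corner (!k) x) ∧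
        (Sub.full P).Reaches (!k) (P.corner (!k) (P.face k i x)) w := by
  induction h using Relation.ReflTransGen.head_induction_on with
  | refl => exact Or.inl Relation.ReflTransGen.refl
  | head h hw ih =>
    obtain ⟨e, -, rfl, rfl⟩ := h
    by_cases he : e ∈ Q.cells 1
    · have hstep := Relation.ReflTransGen.single (r := fun v w => ∃ e ∈ Q.cells 1,
        P.face (!!k) 0 e = v ∧ P.face (!k) 0 e = w) ⟨e, he, rfl, rfl⟩
      exact ih.imp (fun h => hstep.trans h) fun h => ⟨hstep.trans h.1, h.2⟩
    · right
      rcases (hc.notMem_iff _ _).1 he with h | h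
      · exact absurd (congrArg Sigma.fst h) (by simp)
      -- The missing edge is the free face itself, so `x` is a square.
      · obtain rfl : n = 0 := by simpa using (congrArg Sigma.fst h).symm
        obtain rfl : e = P.face k i x := eq_of_heq (Sigma.mk.inj h).2
        exact ⟨hc.reaches_corner (((IsIteratedFace.refl.face k i)).face _ _), hw⟩

end IsElementaryCollapse

/-! ### Regular elements with a free face -/

theorem CubeCell.face_top_injective : ∀ (n : ℕ) {k l : Bool} {i j : Fin (n + 1)},
    CubeCell.face l j (CubeCell.top (n + 1)) = CubeCell.face k i (CubeCell.top (n + 1)) →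
      (l, j) = (k, i) := by
  intro n
  induction n with
  | zero =>
    intro k l i j h
    rw [Subsingleton.elim (α := Fin 1) i 0, Subsingleton.elim (α := Fin 1) j 0] at *
    change CubeCell.face l 0 (CubeCell.edge _) = CubeCell.face k 0 (CubeCell.edge _) at h
    rw [face_zero_edge, face_zero_edge] at h
    injection h with _ _ h
    rw [h]
  | succ n ih =>
    intro k l i j h
    change CubeCell.face l j (CubeCell.edge (CubeCell.top (n + 1))) =
      CubeCell.face k i (CubeCell.edge (CubeCell.top (n + 1))) at h
    revert h
    refine Fin.cases ?_ (fun i => ?_) i <;> refine Fin.cases ?_ (fun j => ?_) j <;>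
      simp only [face_zero_edge, face_succ_edge] <;> intro h
    · injection h with _ _ h
      rw [h]
    · cases h
    · cases h
    · injection h with _ _ h
      have := Prod.mk.inj (ih h)
      rw [this.1, this.2]

/-- The only consequence of regularity that the collapse requires. -/
theorem IsRegular.eq_of_face_eq {P : PrecubicalSet.{u}} {n : ℕ} {x : P.cell (n + 1)}
    (hx : P.IsRegular x) {k l : Bool} {i j : Fin (n + 1)} (h : P.face l j x = P.face k i x) :
    (l, j) = (k, i) := by
  have hface : ∀ (l : Bool) (j : Fin (n + 1)),
      (P.sharp x).toFun n (CubeCell.face l j (CubeCell.top (n + 1))) = P.face l j x := fun l j =>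
    ((P.sharp x).map_face l j (CubeCell.top (n + 1))).trans (congrArg (P.face l j) (P.sharp_top x))
  refine CubeCell.face_top_injective n (hx n ?_)
  rw [hface, hface, h]

theorem IsFreeFace.isElementaryCollapse {P : PrecubicalSet.{u}} {n : ℕ} {k : Bool}
    {i : Fin (n + 1)} {x : P.cell (n + 1)} (hfree : P.IsFreeFace k i x) (hreg : P.IsRegular x) :
    IsElementaryCollapse (P.compStar ⟨n, P.face k i x⟩) k i x where
  notMem_iff m y := by
    change ¬ ¬ ((⟨m, y⟩ : P.Elem) ∈ P.star ⟨n, P.face k i x⟩) ↔ _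
    rw [not_not, show P.star ⟨n, P.face k i x⟩ = _ from hfree]
    rfl
  eq_of_face_eq _ _ h := hreg.eq_of_face_eq h

/-! ### Pushing homology classes into the smaller precubical set -/

theorem Sub.range_homologyMap_mono (R : Type v) [CommRing R] {P : PrecubicalSet.{u}} {X Y : P.Sub}
    (h : X ≤ Y) : LinearMap.range (homologyMap R X.incl.realization) ≤
      LinearMap.range (homologyMap R Y.incl.realization) :=
  Hom.range_homologyMap_comp_le R Y.incl (Sub.inclusion h)

/-- Both images are compared with that of the common larger subset `D`, whose homology is all hit by
that of `Y`. -/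
theorem Sub.DeformableInto.range_homologyMap_le (R : Type v) [CommRing R] {P : PrecubicalSet.{u}}
    {X Y : P.Sub} (h : X.DeformableInto Y) : LinearMap.range (homologyMap R X.incl.realization) ≤
      LinearMap.range (homologyMap R Y.incl.realization) := by
  obtain ⟨D, hX, hY, he⟩ := h
  refine (Sub.range_homologyMap_mono R hX).trans ?_
  have : Y.incl.realization = D.incl.realization.comp (Sub.inclusion hY).realization :=
    Hom.realization_comp D.incl (Sub.inclusion hY)
  rw [this, homologyMap_comp, LinearMap.range_comp_of_range_eq_top]
  exact LinearMap.range_eq_top.2 (he.bijective_homologyMap R).2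

/-- The union of two precubical subsets. -/
def Sub.union {P : PrecubicalSet.{u}} (X Y : P.Sub) : P.Sub where
  cells n := X.cells n ∪ Y.cells n
  face_mem k i _ h := h.imp (X.face_mem k i) (Y.face_mem k i)

/-- The intersection with `Q`, as a precubical subset of `X`. -/
def Sub.restrict {P : PrecubicalSet.{u}} (Q X : P.Sub) : X.toPrecubicalSet.Sub where
  cells n := {y | y.1 ∈ Q.cells n}
  face_mem k i _ h := Q.face_mem k i h

theorem Sub.elem_eq_iff {P : PrecubicalSet.{u}} {X : P.Sub} {m n : ℕ}
    {y : X.toPrecubicalSet.cell m} {z : X.toPrecubicalSet.cell n} :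
    (⟨m, y⟩ : X.toPrecubicalSet.Elem) = ⟨n, z⟩ ↔ (⟨m, y.1⟩ : P.Elem) = ⟨n, z.1⟩ := by
  constructor
  · intro h
    cases h
    rfl
  · intro h
    obtain rfl : m = n := congrArg Sigma.fst h
    rw [Subtype.ext (eq_of_heq (Sigma.mk.inj h).2)]

theorem IsElementaryCollapse.restrict {P : PrecubicalSet.{u}} {Q : P.Sub} {n : ℕ} {k : Bool}
    {i : Fin (n + 1)} {x : P.cell (n + 1)} (hc : IsElementaryCollapse Q k i x) {X : P.Sub}
    (hx : x ∈ X.cells (n + 1)) :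
    IsElementaryCollapse (P := X.toPrecubicalSet) (Q.restrict X) k i ⟨x, hx⟩ where
  notMem_iff m y := (hc.notMem_iff m y.1).trans
    (or_congr (Sub.elem_eq_iff (z := (⟨x, hx⟩ : X.toPrecubicalSet.cell (n + 1)))).symm
      (Sub.elem_eq_iff (z := X.toPrecubicalSet.face k i ⟨x, hx⟩)).symm)
  eq_of_face_eq l j h := hc.eq_of_face_eq l j (congrArg Subtype.val h)

/-- The homology classes in `X` come from a precubical subset of `Q` all of whose new vertices are
vertices of `x`, and there are none unless the free face of `x` lies in `X`. -/
theorem IsElementaryCollapse.exists_hom (R : Type v) [CommRing R] {P : PrecubicalSet.{u}}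
    {Q : P.Sub} {n : ℕ} {k : Bool} {i : Fin (n + 1)} {x : P.cell (n + 1)}
    (hc : IsElementaryCollapse Q k i x) (X : P.Sub) :
    ∃ (A : PrecubicalSet.{u}) (f : Hom A Q.toPrecubicalSet),
      LinearMap.range (homologyMap R X.incl.realization) ≤
        LinearMap.range (homologyMap R (Q.incl.comp f).realization) ∧
      ∀ a, (f.toFun 0 a).1 ∈ X.cells 0 ∨
        P.face k i x ∈ X.cells n ∧ P.IsIteratedFace (f.toFun 0 a).1 x := by
  by_cases hd : P.face k i x ∈ X.cells n
  -- Adding all faces of `x` to `X` gives a set that contains `x`, so the collapse restricts to it.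
  · have hx : x ∈ (X.union (P.faceClosure x)).cells (n + 1) := Or.inr .refl
    refine ⟨(Q.restrict (X.union (P.faceClosure x))).toPrecubicalSet,
      ⟨fun _ y => ⟨y.1.1, Set.mem_ofPred_eq ▸ y.2⟩, fun _ _ _ => rfl⟩, ?_, ?_⟩
    · refine (Sub.range_homologyMap_mono R (Y := X.union (P.faceClosure x))
        fun _ _ h => Or.inl h).trans ?_
      change _ ≤ LinearMap.range (homologyMap R ((X.union (P.faceClosure x)).incl.comp
        (Q.restrict (X.union (P.faceClosure x))).incl).realization)
      rw [Hom.realization_comp, homologyMap_comp, LinearMap.range_comp_of_range_eq_top]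
      exact LinearMap.range_eq_top.2
        ((hc.restrict hx).isHomotopyEquivalence.bijective_homologyMap R).2
    · exact fun a => a.1.2.imp id fun h => ⟨hd, h⟩
  · have hXQ : X ≤ Q := by
      intro m y hy
      by_contra hyQ
      rcases (hc.notMem_iff _ _).1 hyQ with h | h
      · obtain rfl : m = n + 1 := congrArg Sigma.fst h
        obtain rfl : y = x := eq_of_heq (Sigma.mk.inj h).2
        exact hd (X.face_mem k i hy)
      · obtain rfl : m = n := congrArg Sigma.fst h
        obtain rfl : y = P.face k i x := eq_of_heq (Sigma.mk.inj h).2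
        exact hd hy
    exact ⟨X.toPrecubicalSet, Sub.inclusion hXQ, le_rfl, fun a => Or.inl a.2⟩

theorem mem_range_homologyMap_of_comp {R : Type v} [CommRing R] {A B D : PrecubicalSet.{u}}
    {g : Hom B D} {f : Hom A B} (hg : Function.Injective (homologyMap R g.realization))
    {α : SingularHomology R B.Realization} (h : homologyMap R g.realization α ∈
      LinearMap.range (homologyMap R (g.comp f).realization)) :
    α ∈ LinearMap.range (homologyMap R f.realization) := by
  rw [Hom.realization_comp, homologyMap_comp] at h
  obtain ⟨a, ha⟩ := h
  exact ⟨a, hg ha⟩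

/-- Paths from `X` to `Y` in `P` yield paths in `Q` from the vertices pushed out of `X` to the
vertices of a suitable deformation of `Y`. -/
theorem IsElementaryCollapse.reaches_of_reaches {P : PrecubicalSet.{u}}
    {Q : P.Sub} {n : ℕ} {k : Bool} {i : Fin (n + 2)} {x : P.cell (n + 2)}
    (hc : IsElementaryCollapse Q k i x) {X Y : P.Sub}
    (hXY : ∀ v ∈ X.cells 0, ∀ w ∈ Y.cells 0, (Sub.full P).Reaches (!k) v w) {v w' : P.cell 0}
    (hv : v ∈ X.cells 0 ∨ P.face k i x ∈ X.cells (n + 1) ∧ P.IsIteratedFace v x)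
    (hw : ∃ w ∈ Y.cells 0, Q.Reaches (!k) w w' ∧
      ((Sub.full P).Reaches (!k) (P.corner (!k) (P.face k i x)) w →
        Q.Reaches (!k) (P.corner (!k) x) w')) :
    Q.Reaches (!k) v w' := by
  obtain ⟨w, hwY, hww', hB⟩ := hw
  rcases hv with hv | ⟨hd, hv⟩
  · rcases hc.reaches_or (hXY v hv w hwY) with h | ⟨h, h'⟩
    · exact h.trans hww'
    · exact h.trans (hB h')
  · exact (hc.reaches_corner hv).trans
      (hB (hXY _ ((isIteratedFace_corner (!k) (P.face k i x)).mem hd) w hwY))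

theorem PointsTo.map {R : Type v} [CommRing R] {A P : PrecubicalSet.{u}} (f : Hom A P)
    {α β : SingularHomology R A.Realization} (h : PointsTo R A α β) :
    PointsTo R P (homologyMap R f.realization α) (homologyMap R f.realization β) := by
  obtain ⟨X, Y, ⟨a, rfl⟩, ⟨b, rfl⟩, hXY⟩ := h
  refine PointsTo.of_hom (f.comp X.incl) (f.comp Y.incl) ?_ ?_ fun v w => ?_
  · rw [Hom.realization_comp, homologyMap_comp]
    exact ⟨a, rfl⟩
  · rw [Hom.realization_comp, homologyMap_comp]
    exact ⟨b, rfl⟩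
  · have h := accessible_iff_reaches.1 (hXY v.1 v.2 w.1 w.2)
    refine accessible_iff_reaches.2 (Relation.ReflTransGen.lift (f.toFun 0) ?_ _ _ h)
    rintro _ _ ⟨e, -, rfl, rfl⟩
    exact ⟨f.toFun 1 e, trivial, (f.map_face _ _ _).symm, (f.map_face _ _ _).symm⟩

end PrecubicalSet

/-! ### The isomorphism of homology graphs -/

theorem theorem4 (R : Type v) [CommRing R] (P : PrecubicalSet.{u}) {n : ℕ} (x : P.cell (n + 2))
    (k : Bool) (i : Fin (n + 2)) (hreg : P.IsRegular x) (hfree : P.IsFreeFace k i x)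
    (Q : P.Sub) (hQ : Q = P.compStar ⟨n + 1, P.face k i x⟩)
    (hdef : ∀ C : P.Sub, ∃ C' : P.Sub, C' ≤ Q ∧ C.DeformableInto C' ∧
      ∀ c' ∈ C'.cells 0, ∃ c ∈ C.cells 0,
        (k = false → Q.Accessible c c' ∧
          (P.Accessible (P.corner true (P.face false i x)) c →
            Q.Accessible (P.corner true x) c')) ∧
        (k = true → Q.Accessible c' c ∧
          (P.Accessible c (P.corner false (P.face true i x)) →
            Q.Accessible c' (P.corner false x)))) :
    Function.Bijective (PrecubicalSet.homologyMap R Q.incl.realization) ∧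
      ∀ α β : PrecubicalSet.SingularHomology R Q.toPrecubicalSet.Realization,
        PrecubicalSet.PointsTo R Q.toPrecubicalSet α β ↔
          PrecubicalSet.PointsTo R P (PrecubicalSet.homologyMap R Q.incl.realization α)
            (PrecubicalSet.homologyMap R Q.incl.realization β) := by
  have hc : PrecubicalSet.IsElementaryCollapse Q k i x := hQ ▸ hfree.isElementaryCollapse hreg
  have hbij := hc.isHomotopyEquivalence.bijective_homologyMap R
  refine ⟨hbij, fun α β => ⟨fun h => h.map Q.incl, ?_⟩⟩
  rintro ⟨X, Y, hα, hβ, hXY⟩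
  -- The two missing elements have degrees `n + 2` and `n + 1`, so no vertex is lost.
  have hvert : ∀ v : P.cell 0, v ∈ Q.cells 0 := hc.mem_of_ne (by omega) (by omega)
  simp only [PrecubicalSet.Sub.accessible_iff_reaches (hvert _),
    PrecubicalSet.accessible_iff_reaches] at hdef hXY
  cases k with
  | false =>
    obtain ⟨A, f, hf, hfX⟩ := hc.exists_hom R X
    obtain ⟨C, hCQ, hYC, hC⟩ := hdef Y
    refine PrecubicalSet.PointsTo.of_hom f (PrecubicalSet.Sub.inclusion hCQ)
      (PrecubicalSet.mem_range_homologyMap_of_comp hbij.1 (hf hα))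
      (PrecubicalSet.mem_range_homologyMap_of_comp hbij.1 (hYC.range_homologyMap_le R hβ))
      fun a b => ?_
    obtain ⟨_, _, h⟩ := (PrecubicalSet.Sub.accessible_iff_reaches (hvert _)).2
      (hc.reaches_of_reaches hXY (hfX a) (by
        obtain ⟨w, hw, h, -⟩ := hC b.1 b.2
        exact ⟨w, hw, h rfl⟩))
    exact h
  | true =>
    obtain ⟨A, f, hf, hfY⟩ := hc.exists_hom R Y
    obtain ⟨C, hCQ, hXC, hC⟩ := hdef X
    refine PrecubicalSet.PointsTo.of_hom (PrecubicalSet.Sub.inclusion hCQ) f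
      (PrecubicalSet.mem_range_homologyMap_of_comp hbij.1 (hXC.range_homologyMap_le R hα))
      (PrecubicalSet.mem_range_homologyMap_of_comp hbij.1 (hf hβ))
      fun b a => ?_
    -- In direction `false` the paths run from `Y` to `X`, hence the reversals.
    obtain ⟨_, _, h⟩ := (PrecubicalSet.Sub.accessible_iff_reaches (hvert _)).2
      (hc.reaches_of_reaches (fun v hv w hw => (hXY w hw v hv).reverse) (hfY a) (by
        obtain ⟨w, hw, -, h⟩ := hC b.1 b.2
        exact ⟨w, hw, (h rfl).1.reverse, fun h' => ((h rfl).2 h'.reverse).reverse⟩)).reverse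
    exact h
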